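/- All series are formal power series over $\mathbb{Q}$. Write ${}_3F_2([a_1,a_2,a_3],[b_1,b_2],x)=\sum_{n\ge 0}\frac{(a_1)_n(a_2)_n(a_3)_n}{(b_1)_n(b_2)_n\,n!}x^n$, where $(a)_n=a(a+1)\cdots(a+n-1)$. The diagonal of $F=\sum c_{m_1,\dots,m_n}x_1^{m_1}\cdots x_n^{m_n}$ is $\mathrm{Diag}(F)=\sum_{m\ge0}c_{m,\dots,m}x^m$. The diagonal of a rational function $P/Q$, with $P,Q\in\mathbb{Q}[x_1,\dots,x_n]$ and $Q(0,\dots,0)\ne0$, is the diagonal of its Taylor expansion at the origin. For $\alpha\in\mathbb{Q}$, $(1-x-y)^{\alpha}=\sum_{k\ge 0}\binom{\alpha}{k}(-x-y)^k$. (1) One has $${}_3F_2\left(\left[\tfrac29,\tfrac59,\tfrac89\right],\left[\tfrac23,1\right],27x\right)=\mathrm{Diag}\left(\frac{(1-x-y)^{1/3}}{1-x-y-z}\right),$$ $${}_3F_2\left(\left[\tfrac19,\tfrac49,\tfrac79\right],\left[\tfrac13,1\right],27x\right)=\mathrm{Diag}\left(\frac{(1-x-y)^{2/3}}{1-x-y-z}\right).$$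 (2) For $a\in\{1,2\}$ define the rational functions $$r(x,y,z,t)=\frac{3t^2(t+1)^2(xt+yt+zt-1)^3}{(t+1)^3(xt+yt+zt-1)^3+(1-xt-yt)^a}+1,$$ $$r_1(x,y,z,u,v)=\frac{u\,r(x,y,z,u)-v\,r(x,y,z,v)}{u-v},$$ $$r_2(x,y,z,u,v,w)=\frac{v\,r_1(x,y,z,u,v)-w\,r_1(x,y,z,u,w)}{v-w}.$$ Then the six-variable rational function $r_2\in\mathbb{Q}(x,y,z,u,v,w)$ can be written as $P/Q$ with polynomials $P,Q$ over $\mathbb{Q}$ such that $Q(0,\dots,0)\neq0$, and its diagonal is ${}_3F_2([2/9,5/9,8/9],[2/3,1],27x)$ if $a=1$, and ${}_3F_2([1/9,4/9,7/9],[1/3,1],27x)$ if $a=2$. (3) In particular Christol's candidate series, ${}_3F_2([2/9,5/9,8/9],[2/3,1],cx)$ and ${}_3F_2([1/9,4/9,7/9],[1/3,1],cx)$ with $c=1$ as well as with $c=3^6$, are diagonals of rational functions in six variables. -/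

import Mathlib

noncomputable section

namespace ChristolDiag

/-- The generalized hypergeometric series `pFq(as; bs; X)` over `ℚ`, as a formal power series:
its `n`-th coefficient is `∏ (a)_n / (∏ (b)_n * n!)`, where `(a)_n` is the rising factorial
`a (a+1) ⋯ (a+n-1)`. (No `b` is supposed to be a non-positive integer.) -/
def hypergeometric (as bs : List ℚ) : PowerSeries ℚ :=
  PowerSeries.mk fun n =>
    (as.map fun a => (ascPochhammer ℚ n).eval a).prod /
      ((bs.map fun b => (ascPochhammer ℚ n).eval b).prod * (n.factorial : ℚ))

/-- The diagonal of a formal power series `∑ c(m₁,…,mₙ) x₁^m₁ ⋯ xₙ^mₙ` in finitely many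
variables: the univariate series `∑ c(m,…,m) x^m`. -/
def diag {σ : Type*} [Finite σ] (F : MvPowerSeries σ ℚ) : PowerSeries ℚ :=
  PowerSeries.mk fun m => MvPowerSeries.coeff (Finsupp.equivFunOnFinite.symm fun _ : σ => m) F

/-- The power `F ^ α` with rational exponent of a formal power series `F` with constant term `1`,
by the binomial expansion `∑ₖ (α choose k) (F - 1)^k`. -/
def ratPow {σ : Type*} (F : MvPowerSeries σ ℚ) (α : ℚ) : MvPowerSeries σ ℚ :=
  (PowerSeries.binomialSeries ℚ α).subst (F - 1)

/-- The formal power series `(1 - x - y)^α / (1 - x - y - z)` in the variables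
`x, y, z = X 0, X 1, X 2`. (The denominator has constant term `1`, so `⁻¹` is its true inverse.) -/
def algebraicSeries (α : ℚ) : MvPowerSeries (Fin 3) ℚ :=
  ratPow (1 - MvPowerSeries.X 0 - MvPowerSeries.X 1) α *
    (1 - MvPowerSeries.X 0 - MvPowerSeries.X 1 - MvPowerSeries.X 2)⁻¹

/-- The field `ℚ(x₁,…,xₙ)` of rational functions in the variables indexed by `σ`. -/
abbrev RationalFunction (σ : Type*) : Type _ := FractionRing (MvPolynomial σ ℚ)

/-- `R` is a rational function that can be written as `P / Q` with polynomials `P`, `Q` such that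
`Q(0,…,0) ≠ 0`, and the diagonal of its Taylor expansion at the origin is `f`.
(As `Q(0,…,0) ≠ 0`, the power series `(Q)⁻¹` is the true inverse of `Q`.) -/
def IsDiagonalOfRational {σ : Type*} [Finite σ] (R : RationalFunction σ) (f : PowerSeries ℚ) :
    Prop :=
  ∃ P Q : MvPolynomial σ ℚ, MvPolynomial.constantCoeff Q ≠ 0 ∧
    R = algebraMap (MvPolynomial σ ℚ) (RationalFunction σ) P /
      algebraMap (MvPolynomial σ ℚ) (RationalFunction σ) Q ∧
    diag ((P : MvPowerSeries σ ℚ) * (Q : MvPowerSeries σ ℚ)⁻¹) = f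

section DenefLipshitz

variable {K : Type*} [Field K]

/-- The rational function in four variables
`3 t² (t+1)² (xt+yt+zt-1)³ / ((t+1)³ (xt+yt+zt-1)³ + (1-xt-yt)^a) + 1`. It is
`t² p_t(xt,yt,zt,t) / p(xt,yt,zt,t) + 1`, where `p(x,y,z,t) = ((x+y+z-1)(t+1))³ + (1-x-y)^a` is
the polynomial that annihilates `(1-x-y)^(a/3) / (1-x-y-z) - 1`. -/
def dlFour (a : ℕ) (x y z t : K) : K :=
  3 * t ^ 2 * (t + 1) ^ 2 * (x * t + y * t + z * t - 1) ^ 3 /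
    ((t + 1) ^ 3 * (x * t + y * t + z * t - 1) ^ 3 + (1 - x * t - y * t) ^ a) + 1

/-- The rational function `(u r(x,y,z,u) - v r(x,y,z,v)) / (u - v)` in five variables, with
`r = dlFour a`. -/
def dlFive (a : ℕ) (x y z u v : K) : K :=
  (u * dlFour a x y z u - v * dlFour a x y z v) / (u - v)

/-- The rational function `(v r₁(x,y,z,u,v) - w r₁(x,y,z,u,w)) / (v - w)` in six variables, with
`r₁ = dlFive a`. -/
def dlSix (a : ℕ) (x y z u v w : K) : K :=
  (v * dlFive a x y z u v - w * dlFive a x y z u w) / (v - w)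

end DenefLipshitz

/-- The `i`-th variable, as an element of the field `ℚ(x₁,…,x₆)`. -/
def var (i : Fin 6) : RationalFunction (Fin 6) :=
  algebraMap (MvPolynomial (Fin 6) ℚ) (RationalFunction (Fin 6)) (MvPolynomial.X i)

/-- `dlSix a` as an element of the field of rational functions in six variables. -/
def denefLipshitz (a : ℕ) : RationalFunction (Fin 6) :=
  dlSix a (var 0) (var 1) (var 2) (var 3) (var 4) (var 5)

end ChristolDiag

end

/-!
The coefficient of `z ^ m` in `(1-x-y)^α / (1-x-y-z)` is `(1-x-y)^(α-m-1)`, so the diagonal has the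
coefficients `(α-m-1 choose 2m) (2m choose m) = (1-α)_{3m} / ((1-α)_m m!²)`; splitting the factors
of `(b)_{3m}` modulo three gives the hypergeometric series (`rescale_hypergeometric_eq_diag`).

To pass from the algebraic function `h = (1-x-y)^(a/3) / (1-x-y-z)` to a rational one, let
`φ = h(xu,yu,zu) - 1`. The polynomial `p(xu,yu,zu,t)` that annihilates it has the simple root
`t = φ`, so that (Furstenberg) `t² p_t / p` is `t² / (t - φ)` plus terms in which `t` has too large
an exponent. Setting `t = u`, this becomes a statement about the series `r(x,y,z,u)`: give a
monomial the weight "degree in `u` minus degree in the other variables". Then `φ = u ψ` has weight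
`0` and `ψ` weight `-1`, and
`r = h(xu,yu,zu) + u + φ ψ / (1 - ψ) + u² · (something of weight ≥ 0)`,
so the part of weight `0` of `r` is `h(xu,yu,zu)`. Hence the coefficient of `(xyz)^m u^(3m)` in `r`
is the diagonal coefficient of `h` (`coeff_dlSeries`). The bounds on weights rest on the fact that
the series of weight at most `0` are closed under inversion (`WeightLE.inv`).

Finally, `G ↦ (u G(u) - v G(v)) / (u - v)` replaces `u ^ n` by the sum of all `u ^ a * v ^ b` with
`a + b = n` (`sub_mul_splitVar`). Doing this twice turns the coefficient of `(xyz)^m u^(3m)` into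
that of `(xyzuvw)^m` (`coeff_diag_splitVar_splitVar`), and yields the Taylor expansion of `r₂`
(`taylor_dlSix`), whose denominator is a product of three values of `dlDen`, with constant
term `-27`. A change of scale in one variable gives the arguments `x` and `3 ^ 6 x`
(`IsDiagonalOfRational.rescale`).
-/

noncomputable section

namespace ChristolDiag

/-! ### Power series with monomials of bounded weight -/

section Weight

variable {σ R : Type*}

/-- All monomials of `F` have `w`-weight at most `k`. -/
def WeightLE [Semiring R] (w : σ → ℤ) (k : ℤ) (F : MvPowerSeries σ R) : Prop :=
  ∀ s, k < Finsupp.weight w s → MvPowerSeries.coeff s F = 0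

theorem WeightLE.mono [Semiring R] {w : σ → ℤ} {j k : ℤ} {F : MvPowerSeries σ R}
    (hF : WeightLE w j F) (h : j ≤ k) : WeightLE w k F :=
  fun s hs => hF s (h.trans_lt hs)

theorem WeightLE.add [Semiring R] {w : σ → ℤ} {k : ℤ} {F G : MvPowerSeries σ R}
    (hF : WeightLE w k F) (hG : WeightLE w k G) : WeightLE w k (F + G) := fun s hs => by
  rw [map_add, hF s hs, hG s hs, add_zero]

theorem WeightLE.sub [Ring R] {w : σ → ℤ} {k : ℤ} {F G : MvPowerSeries σ R}
    (hF : WeightLE w k F) (hG : WeightLE w k G) : WeightLE w k (F - G) := fun s hs => by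
  rw [map_sub, hF s hs, hG s hs, sub_zero]

theorem WeightLE.sum [Semiring R] {ι : Type*} {w : σ → ℤ} {k : ℤ} {S : Finset ι}
    {F : ι → MvPowerSeries σ R} (hF : ∀ i ∈ S, WeightLE w k (F i)) :
    WeightLE w k (∑ i ∈ S, F i) := fun s hs => by
  rw [map_sum, Finset.sum_eq_zero fun i hi => hF i hi s hs]

theorem WeightLE.mul [Semiring R] {w : σ → ℤ} {j k : ℤ} {F G : MvPowerSeries σ R}
    (hF : WeightLE w j F) (hG : WeightLE w k G) : WeightLE w (j + k) (F * G) := fun s hs => by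
  classical
  rw [MvPowerSeries.coeff_mul]
  refine Finset.sum_eq_zero fun p hp => ?_
  rw [← Finset.HasAntidiagonal.mem_antidiagonal.1 hp, map_add] at hs
  rcases lt_or_ge j (Finsupp.weight w p.1) with h | h
  · rw [hF _ h, zero_mul]
  · rw [hG _ (by linarith), mul_zero]

theorem WeightLE.mul_of_zero [Semiring R] {w : σ → ℤ} {F G : MvPowerSeries σ R}
    (hF : WeightLE w 0 F) (hG : WeightLE w 0 G) : WeightLE w 0 (F * G) := by
  simpa using hF.mul hG

theorem weightLE_C [Semiring R] (w : σ → ℤ) (c : R) :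
    WeightLE w 0 (MvPowerSeries.C c) := fun s hs => by
  classical
  rw [MvPowerSeries.coeff_C, if_neg]
  rintro rfl
  simp at hs

theorem weightLE_one [Semiring R] (w : σ → ℤ) :
    WeightLE w 0 (1 : MvPowerSeries σ R) := weightLE_C w 1

theorem weightLE_ofNat [Semiring R] (w : σ → ℤ) (n : ℕ) [n.AtLeastTwo] :
    WeightLE w 0 (OfNat.ofNat n : MvPowerSeries σ R) := by
  rw [← map_ofNat (MvPowerSeries.C (σ := σ) (R := R)) n]
  exact weightLE_C w _

theorem weightLE_X [Semiring R] {w : σ → ℤ} {k : ℤ} (i : σ) (h : w i ≤ k) :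
    WeightLE w k (MvPowerSeries.X i : MvPowerSeries σ R) := fun s hs => by
  classical
  rw [MvPowerSeries.coeff_X, if_neg]
  rintro rfl
  simp [Finsupp.weight_single] at hs
  omega

theorem WeightLE.pow [Semiring R] {w : σ → ℤ} {F : MvPowerSeries σ R}
    (hF : WeightLE w 0 F) (n : ℕ) : WeightLE w 0 (F ^ n) := by
  induction n with
  | zero => simpa using weightLE_one w
  | succ n ih => simpa [pow_succ] using ih.mul hF

/-- In the recursion for the coefficients of the inverse, an exponent of positive weight is a sum
of two exponents one of which has positive weight. -/
theorem WeightLE.inv {K : Type*} [Field K] {w : σ → ℤ} {F : MvPowerSeries σ K}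
    (hF : WeightLE w 0 F) : WeightLE w 0 F⁻¹ := by
  classical
  intro s
  induction s using WellFoundedLT.induction with
  | ind s ih =>
    intro hs
    rw [MvPowerSeries.coeff_inv, if_neg (by rintro rfl; simp at hs)]
    rw [Finset.sum_eq_zero, mul_zero]
    intro p hp
    split_ifs with hlt
    · rw [← Finset.HasAntidiagonal.mem_antidiagonal.1 hp, map_add] at hs
      rcases lt_or_ge 0 (Finsupp.weight w p.1) with h | h
      · rw [hF _ h, zero_mul]
      · rw [ih _ hlt (by linarith), mul_zero]
    · rfl

end Weight

/-! ### Splitting a variable of a power series -/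

section Split

variable {σ R : Type*} [CommRing R]

/-- The exponent of the monomial `s` with `X j` replaced by `X i`. -/
def mergeExp (i j : σ) (s : σ →₀ ℕ) : σ →₀ ℕ := (s.update i (s i + s j)).update j 0

/-- The linear operator that replaces each power `X i ^ n` by the complete homogeneous polynomial
`∑ X i ^ a * X j ^ b` over `a + b = n`, for series in which `X j` does not occur. -/
def splitVar (i j : σ) (G : MvPowerSeries σ R) : MvPowerSeries σ R :=
  fun s => MvPowerSeries.coeff (mergeExp i j s) G

theorem coeff_splitVar (i j : σ) (G : MvPowerSeries σ R) (s : σ →₀ ℕ) :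
    MvPowerSeries.coeff s (splitVar i j G) = MvPowerSeries.coeff (mergeExp i j s) G := rfl

theorem coeff_X_mul (i : σ) (F : MvPowerSeries σ R) (s : σ →₀ ℕ) :
    MvPowerSeries.coeff s (MvPowerSeries.X i * F) =
      if s i = 0 then 0 else MvPowerSeries.coeff (s - Finsupp.single i 1) F := by
  rw [MvPowerSeries.X, MvPowerSeries.coeff_monomial_mul, one_mul]
  simp only [Finsupp.single_le_iff]
  split_ifs <;> first | rfl | omega

theorem coeff_renameEquiv [Finite σ] (e : σ ≃ σ) (F : MvPowerSeries σ R) (s : σ →₀ ℕ) :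
    MvPowerSeries.coeff s (MvPowerSeries.rename e F) =
      MvPowerSeries.coeff (Finsupp.equivMapDomain e.symm s) F := by
  have := MvPowerSeries.coeff_embDomain_rename e.toEmbedding F (Finsupp.equivMapDomain e.symm s)
  rw [← this]
  refine congrArg (fun t => MvPowerSeries.coeff t _) (Finsupp.ext fun k => ?_)
  obtain ⟨k, rfl⟩ := e.surjective k
  have h := Finsupp.embDomain_apply_self e.toEmbedding (Finsupp.equivMapDomain e.symm s) k
  simp only [Equiv.coe_toEmbedding] at h
  rw [h]
  simp

/-- Since `(u - v) * ∑ u ^ a * v ^ b = u ^ (n + 1) - v ^ (n + 1)`, the sum over `a + b = n`,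
splitting a variable is the operation `G ↦ (u G(u) - v G(v)) / (u - v)`. The hypothesis says that
`X j` does not occur in `G`. -/
theorem sub_mul_splitVar [Finite σ] [DecidableEq σ] {i j : σ} (hij : i ≠ j) {G : MvPowerSeries σ R}
    (hG : WeightLE (Pi.single j 1) 0 G) :
    (MvPowerSeries.X i - MvPowerSeries.X j) * splitVar i j G =
      MvPowerSeries.X i * G - MvPowerSeries.X j * MvPowerSeries.rename (Equiv.swap i j) G := by
  have hG' : ∀ s : σ →₀ ℕ, s j ≠ 0 → MvPowerSeries.coeff s G = 0 := by
    intro s hs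
    apply hG
    rw [Finsupp.weight_single_index]
    simp
    omega
  ext s
  simp only [sub_mul, map_sub, coeff_X_mul, coeff_splitVar, coeff_renameEquiv]
  by_cases hj : s j = 0
  · by_cases hi : s i = 0
    · simp [hi, hj]
    · simp only [hi, hj, if_true, if_false, sub_zero]
      refine congrArg (fun t => MvPowerSeries.coeff t G) (Finsupp.ext fun k => ?_)
      by_cases h1 : k = j <;> by_cases h2 : k = i <;>
        simp_all [mergeExp, Function.update, hij.symm]
  · by_cases hi : s i = 0
    · simp only [hi, hj, if_true, if_false, zero_sub]
      refine neg_inj.2 <| congrArg (fun t => MvPowerSeries.coeff t G) (Finsupp.ext fun k => ?_)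
      by_cases h1 : k = j
      · subst h1
        simp_all [mergeExp, Function.update]
      · by_cases h2 : k = i
        · subst h2
          simp_all [mergeExp, Function.update]
        · simp_all [mergeExp, Function.update, Equiv.swap_apply_of_ne_of_ne]
    · -- both terms on the right vanish, and the two terms on the left cancel
      simp only [hi, hj, if_false]
      rw [hG' (s - Finsupp.single i 1) (by simpa [Finsupp.single_apply, hij] using hj),
        hG' (Finsupp.equivMapDomain _ _)
          (by simpa [Finsupp.single_apply, hij, Ne.symm hij] using hi), sub_zero, sub_eq_zero]
      refine congrArg (fun t => MvPowerSeries.coeff t G) (Finsupp.ext fun k => ?_)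
      by_cases h1 : k = j <;> by_cases h2 : k = i <;>
        simp_all [mergeExp, Function.update, hij.symm]
      omega

theorem WeightLE.splitVar [DecidableEq σ] {i j k : σ} (hi : i ≠ k) (hj : j ≠ k)
    {G : MvPowerSeries σ R} (hG : WeightLE (Pi.single k 1) 0 G) :
    WeightLE (Pi.single k 1) 0 (splitVar i j G) := by
  intro s hs
  apply hG
  rw [Finsupp.weight_single_index] at hs ⊢
  simpa [mergeExp, Function.update, hi.symm, hj.symm] using hs

end Split

/-! ### Rational powers of power series -/

section Pow

variable {σ : Type*}

theorem hasSubst_sub_one {F : MvPowerSeries σ ℚ} (hF : MvPowerSeries.constantCoeff F = 1) :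
    PowerSeries.HasSubst (F - 1) :=
  PowerSeries.HasSubst.of_constantCoeff_zero (by simp [hF])

theorem ratPow_add {F : MvPowerSeries σ ℚ} (hF : MvPowerSeries.constantCoeff F = 1) (α β : ℚ) :
    ratPow F (α + β) = ratPow F α * ratPow F β := by
  rw [ratPow, PowerSeries.binomialSeries_add, PowerSeries.subst_mul (hasSubst_sub_one hF)]
  rfl

theorem ratPow_natCast {F : MvPowerSeries σ ℚ} (hF : MvPowerSeries.constantCoeff F = 1) (n : ℕ) :
    ratPow F n = F ^ n := by
  have h := hasSubst_sub_one hF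
  rw [ratPow, PowerSeries.binomialSeries_nat, PowerSeries.subst_pow h, PowerSeries.subst_add h,
    PowerSeries.subst_X h, ← PowerSeries.coe_substAlgHom h, map_one, add_sub_cancel]

theorem ratPow_pow {F : MvPowerSeries σ ℚ} (hF : MvPowerSeries.constantCoeff F = 1) (α : ℚ)
    (n : ℕ) : ratPow F α ^ n = ratPow F (n * α) := by
  induction n with
  | zero => simpa using (ratPow_natCast hF 0).symm
  | succ n ih => rw [pow_succ, ih, ← ratPow_add hF]; congr 1; push_cast; ring

theorem constantCoeff_ratPow {F : MvPowerSeries σ ℚ} (hF : MvPowerSeries.constantCoeff F = 1)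
    (α : ℚ) : MvPowerSeries.constantCoeff (ratPow F α) = 1 := by
  rw [ratPow, PowerSeries.constantCoeff_subst (hasSubst_sub_one hF), finsum_eq_single _ 0]
  · simp
  · intro d hd
    simp [hF, hd]

end Pow

/-! ### The diagonal of the algebraic series -/

section ThreeVariables

open MvPowerSeries

theorem coeff_X_add_X_pow (d : ℕ) (s : Fin 3 →₀ ℕ) :
    coeff s ((X 0 + X 1 : MvPowerSeries (Fin 3) ℚ) ^ d) =
      if s 0 + s 1 = d ∧ s 2 = 0 then (d.choose (s 0) : ℚ) else 0 := by
  have key : ∀ i j : ℕ, coeff s ((X 0 : MvPowerSeries (Fin 3) ℚ) ^ i * X 1 ^ j) =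
      if s 0 = i ∧ s 1 = j ∧ s 2 = 0 then 1 else 0 := by
    intro i j
    rw [X_pow_eq, X_pow_eq, monomial_mul_monomial, coeff_monomial, one_mul]
    refine if_congr ?_ rfl rfl
    rw [Finsupp.ext_iff, Fin.forall_fin_succ, Fin.forall_fin_two]
    simp
  rw [add_pow, map_sum]
  have h : ∀ i ∈ Finset.range (d + 1),
      coeff s ((X 0 : MvPowerSeries (Fin 3) ℚ) ^ i * X 1 ^ (d - i) *
          (d.choose i : MvPowerSeries (Fin 3) ℚ)) =
        if s 0 = i then (if s 0 + s 1 = d ∧ s 2 = 0 then (d.choose (s 0) : ℚ) else 0) else 0 := by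
    intro i hi
    rw [Finset.mem_range] at hi
    rw [← map_natCast (C (σ := Fin 3) (R := ℚ)), coeff_mul_C, key]
    split_ifs <;> first | (subst_vars; simp; done) | omega
  rw [Finset.sum_congr rfl h, Finset.sum_ite_eq]
  split_ifs with h1 h2 h2 <;> first | rfl | skip
  rw [Finset.mem_range] at h1
  omega

theorem coeff_ratPow (β : ℚ) (s : Fin 3 →₀ ℕ) :
    coeff s (ratPow (1 - X 0 - X 1 : MvPowerSeries (Fin 3) ℚ) β) =
      if s 2 = 0 then
        Ring.choose β (s 0 + s 1) * ((-1) ^ (s 0 + s 1) * ((s 0 + s 1).choose (s 0) : ℚ))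
      else 0 := by
  have h : (1 - X 0 - X 1 - 1 : MvPowerSeries (Fin 3) ℚ) = C (-1) * (X 0 + X 1) := by
    rw [map_neg, map_one]; ring
  rw [ratPow, PowerSeries.coeff_subst (hasSubst_sub_one (by simp)),
    finsum_eq_single _ (s 0 + s 1)]
  · rw [h, mul_pow, ← map_pow, coeff_C_mul, coeff_X_add_X_pow]
    simp
  · intro d hd
    rw [h, mul_pow, ← map_pow, coeff_C_mul, coeff_X_add_X_pow, if_neg (by tauto)]
    simp

/-- The geometric expansion in powers of `z`, with remainder, of
`(1 - x - y) ^ α / (1 - x - y - z)`. -/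
theorem algebraicSeries_eq_sum_add (α : ℚ) (n : ℕ) :
    algebraicSeries α = ∑ k ∈ Finset.range n, X 2 ^ k * ratPow (1 - X 0 - X 1) (α - (k + 1)) +
      X 2 ^ n * (ratPow (1 - X 0 - X 1) (α - n) * (1 - X 0 - X 1 - X 2)⁻¹) := by
  have hF : constantCoeff (1 - X 0 - X 1 : MvPowerSeries (Fin 3) ℚ) = 1 := by simp
  have hL : constantCoeff (1 - X 0 - X 1 - X 2 : MvPowerSeries (Fin 3) ℚ) ≠ 0 := by simp
  have hinv := MvPowerSeries.mul_inv_cancel _ hL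
  induction n with
  | zero => simp [algebraicSeries]
  | succ n ih =>
    have hstep : ratPow (1 - X 0 - X 1 : MvPowerSeries (Fin 3) ℚ) (α - n) =
        (1 - X 0 - X 1) * ratPow (1 - X 0 - X 1) (α - (n + 1)) := by
      have h1 := ratPow_natCast hF 1
      rw [pow_one] at h1
      rw [show α - (n : ℚ) = ((1 : ℕ) : ℚ) + (α - (n + 1)) by push_cast; ring, ratPow_add hF, h1]
    rw [ih, Finset.sum_range_succ, hstep, Nat.cast_add_one]
    linear_combination X 2 ^ n * ratPow (1 - X 0 - X 1) (α - (n + 1)) * hinv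

theorem coeff_diag_algebraicSeries (α : ℚ) (m : ℕ) :
    PowerSeries.coeff m (diag (algebraicSeries α)) =
      Ring.choose (α - (m + 1)) (2 * m) * ((2 * m).choose m : ℚ) := by
  rw [diag, PowerSeries.coeff_mk, algebraicSeries_eq_sum_add α (m + 1), map_add, map_sum,
    X_pow_dvd_iff.1 (Dvd.intro _ rfl) _ (by simp), add_zero, Finset.sum_eq_single m]
  · rw [X_pow_eq, coeff_monomial_mul, if_pos (by simp), coeff_ratPow]
    simp [two_mul]
  · intro k hk hkm
    have hkm' : k < m := by rw [Finset.mem_range] at hk; omega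
    rw [X_pow_eq, coeff_monomial_mul, if_pos (by simp; omega), coeff_ratPow, if_neg, mul_zero]
    simp
    omega
  · simp

end ThreeVariables

theorem ascPochhammer_eval_three_mul (b : ℚ) (m : ℕ) :
    (ascPochhammer ℚ (3 * m)).eval b =
      27 ^ m * ((ascPochhammer ℚ m).eval (b / 3) * (ascPochhammer ℚ m).eval ((b + 1) / 3) *
        (ascPochhammer ℚ m).eval ((b + 2) / 3)) := by
  induction m with
  | zero => simp
  | succ m ih =>
    rw [show 3 * (m + 1) = 3 * m + 1 + 1 + 1 by ring]
    simp only [ascPochhammer_succ_eval, ih]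
    push_cast
    ring

/-- With `b = 1 - α`, both sides have the coefficients `(b)_{3m} / ((b)_m m!²)`. -/
theorem rescale_hypergeometric_eq_diag {b : ℚ} (hb : 0 < b) :
    PowerSeries.rescale 27 (hypergeometric [b / 3, (b + 1) / 3, (b + 2) / 3] [b, 1]) =
      diag (algebraicSeries (1 - b)) := by
  ext m
  have h1 : (ascPochhammer ℚ m).eval b * (ascPochhammer ℚ (2 * m)).eval (b + m) =
      (ascPochhammer ℚ (3 * m)).eval b := by
    rw [show 3 * m = m + 2 * m by ring, ← ascPochhammer_mul]
    simp
  have h2 : ((2 * m).factorial : ℚ) * Ring.choose (-(b + m)) (2 * m) =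
      (ascPochhammer ℚ (2 * m)).eval (b + m) := by
    rw [Ring.choose_neg', ← Polynomial.ascPochhammer_smeval_eq_eval,
      ← Ring.factorial_nsmul_multichoose_eq_ascPochhammer]
    simp [Int.negOnePow_two_mul]
  have h3 : ((2 * m).choose m : ℚ) * (m.factorial * m.factorial) = (2 * m).factorial := by
    have := Nat.choose_mul_factorial_mul_factorial (show m ≤ 2 * m by omega)
    rw [show 2 * m - m = m by omega] at this
    rw [← mul_assoc]
    exact_mod_cast this
  have hb' : (ascPochhammer ℚ m).eval b ≠ 0 := (ascPochhammer_pos m b hb).ne'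
  have hm : (m.factorial : ℚ) ≠ 0 := by positivity
  rw [coeff_diag_algebraicSeries, PowerSeries.coeff_rescale, hypergeometric, PowerSeries.coeff_mk,
    show 1 - b - ((m : ℚ) + 1) = -(b + m) by ring]
  simp only [List.map_cons, List.map_nil, List.prod_cons, List.prod_nil, mul_one,
    ascPochhammer_eval_one]
  rw [mul_div_assoc', div_eq_iff (by positivity), ← mul_assoc (Polynomial.eval (b / 3) _),
    ← ascPochhammer_eval_three_mul, ← h1, ← h2, ← h3]
  ring

/-! ### Changing the argument of a diagonal -/

section Rescale

theorem diag_rescale {σ : Type*} [Finite σ] (i : σ) [DecidableEq σ] (c : ℚ)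
    (F : MvPowerSeries σ ℚ) :
    diag (MvPowerSeries.rescale (Pi.mulSingle i c) F) = PowerSeries.rescale c (diag F) := by
  ext m
  rw [PowerSeries.coeff_rescale, diag, diag, PowerSeries.coeff_mk, PowerSeries.coeff_mk,
    MvPowerSeries.coeff_rescale]
  congr 1
  have := Fintype.ofFinite σ
  rw [Finsupp.prod_fintype _ _ (by simp), Finset.prod_eq_single i]
  · simp
  · intro j _ hj; simp [hj]
  · simp

/-- Substituting `c X i` for one of the variables `X i` multiplies the argument of the diagonal
by `c`. -/
theorem IsDiagonalOfRational.rescale {σ : Type*} [Finite σ] [Nonempty σ] {R : RationalFunction σ}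
    {f : PowerSeries ℚ} (h : IsDiagonalOfRational R f) (c : ℚ) :
    ∃ R' : RationalFunction σ, IsDiagonalOfRational R' (PowerSeries.rescale c f) := by
  classical
  obtain ⟨P, Q, hQ, -, rfl⟩ := h
  obtain ⟨i⟩ := ‹Nonempty σ›
  let φ : MvPolynomial σ ℚ →ₐ[ℚ] MvPolynomial σ ℚ :=
    MvPolynomial.aeval fun j => MvPolynomial.C ((Pi.mulSingle i c : σ → ℚ) j) * MvPolynomial.X j
  have hφ : ∀ A : MvPolynomial σ ℚ, ((φ A : MvPolynomial σ ℚ) : MvPowerSeries σ ℚ) =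
      MvPowerSeries.rescale (Pi.mulSingle i c) (A : MvPowerSeries σ ℚ) := by
    intro A
    rw [MvPowerSeries.rescale_eq_subst, MvPowerSeries.subst_coe]
    have : (MvPolynomial.coeToMvPowerSeries.algHom ℚ).comp φ =
        MvPolynomial.aeval
          ((Pi.mulSingle i c : σ → ℚ) • (MvPowerSeries.X : σ → MvPowerSeries σ ℚ)) := by
      ext1 j
      simp [φ, MvPowerSeries.smul_eq_C_mul]
    simpa using DFunLike.congr_fun this A
  have hc : ∀ F : MvPowerSeries σ ℚ, MvPowerSeries.constantCoeff
      (MvPowerSeries.rescale (Pi.mulSingle i c) F) = MvPowerSeries.constantCoeff F := by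
    intro F
    rw [← MvPowerSeries.coeff_zero_eq_constantCoeff_apply, MvPowerSeries.coeff_rescale]
    simp
  have hcoe : ∀ A : MvPolynomial σ ℚ, MvPowerSeries.constantCoeff (A : MvPowerSeries σ ℚ) =
      MvPolynomial.constantCoeff A := fun A => MvPolynomial.coeff_coe A 0
  have hQ' : MvPowerSeries.constantCoeff (Q : MvPowerSeries σ ℚ) ≠ 0 := by rwa [hcoe]
  refine ⟨_, φ P, φ Q, ?_, rfl, ?_⟩
  · rwa [← hcoe, hφ, hc, hcoe]
  · rw [← diag_rescale i]
    congr 1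
    rw [hφ, hφ, map_mul]
    congr 1
    rw [MvPowerSeries.inv_eq_iff_mul_eq_one (by rwa [hc]), ← map_mul,
      MvPowerSeries.inv_mul_cancel _ hQ', map_one]

end Rescale

/-! ### The iterated divided differences as fractions -/

section Fractions

variable {R : Type*} [CommRing R]

/-- The polynomial `p(xt,yt,zt,t) / t`, where `p(x,y,z,t) = ((x+y+z-1)(t+1))³ + (1-x-y)^a` has no
constant term. -/
def dlDen (a : ℕ) (x y z t : R) : R :=
  (x + y + z + (x + y + z) * t - 1) *
      (3 + 3 * t * (1 - (x + y + z) - (x + y + z) * t) +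
        t ^ 2 * (1 - (x + y + z) - (x + y + z) * t) ^ 2) -
    (x + y) * ∑ i ∈ Finset.range a, (1 - x * t - y * t) ^ i

/-- The numerator of `dlFour a` over the denominator `dlDen a`. -/
def dlNum (a : ℕ) (x y z t : R) : R :=
  3 * t * (t + 1) ^ 2 * (x * t + y * t + z * t - 1) ^ 3 + dlDen a x y z t

theorem mul_dlDen (a : ℕ) (x y z t : R) :
    t * dlDen a x y z t =
      (t + 1) ^ 3 * (x * t + y * t + z * t - 1) ^ 3 + (1 - x * t - y * t) ^ a := by
  have h := mul_neg_geom_sum (1 - x * t - y * t) a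
  rw [dlDen]
  linear_combination -h

theorem map_dlDen {S F : Type*} [CommRing S] [FunLike F R S] [RingHomClass F R S] (f : F) (a : ℕ)
    (x y z t : R) : f (dlDen a x y z t) = dlDen a (f x) (f y) (f z) (f t) := by
  simp [dlDen, map_ofNat f]

theorem map_dlNum {S F : Type*} [CommRing S] [FunLike F R S] [RingHomClass F R S] (f : F) (a : ℕ)
    (x y z t : R) : f (dlNum a x y z t) = dlNum a (f x) (f y) (f z) (f t) := by
  simp [dlNum, map_dlDen, map_ofNat f]

/-- For a quotient `A / B` of polynomials, the numerator of `(u A(u)/B(u) - v A(v)/B(v)) / (u - v)`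
is a polynomial in `v`. -/
theorem exists_divided_difference (A B : Polynomial R) (u : R) :
    ∃ P : Polynomial R, ∀ v, (u - v) * P.eval v =
      u * A.eval u * B.eval v - v * A.eval v * B.eval u := by
  obtain ⟨P, hP⟩ := (Polynomial.dvd_iff_isRoot
    (p := Polynomial.C (u * A.eval u) * B - Polynomial.X * A * Polynomial.C (B.eval u))
    (a := u)).2 (by simp [Polynomial.IsRoot])
  refine ⟨-P, fun v => ?_⟩
  have := congrArg (Polynomial.eval v) hP
  simp only [Polynomial.eval_sub, Polynomial.eval_mul, Polynomial.eval_C, Polynomial.eval_X] at this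
  rw [Polynomial.eval_neg]
  linear_combination -this

/-- The numerators of the two iterated divided differences that define `dlFive` and `dlSix`,
over the denominators `dlDen(u) dlDen(v)`, `dlDen(u) dlDen(w)` and
`dlDen(u) dlDen(v) dlDen(w)`. -/
theorem exists_numerators (a : ℕ) (x y z u v w : R) : ∃ P Pv Pw : R,
    (u - v) * Pv = u * dlNum a x y z u * dlDen a x y z v - v * dlNum a x y z v * dlDen a x y z u ∧
    (u - w) * Pw = u * dlNum a x y z u * dlDen a x y z w - w * dlNum a x y z w * dlDen a x y z u ∧
    (v - w) * P = v * Pv * dlDen a x y z w - w * Pw * dlDen a x y z v := by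
  let A : Polynomial R := dlNum a (.C x) (.C y) (.C z) .X
  let B : Polynomial R := dlDen a (.C x) (.C y) (.C z) .X
  have hA : ∀ t, A.eval t = dlNum a x y z t := fun t => by
    simpa using map_dlNum (Polynomial.evalRingHom t) a (.C x) (.C y) (.C z) .X
  have hB : ∀ t, B.eval t = dlDen a x y z t := fun t => by
    simpa using map_dlDen (Polynomial.evalRingHom t) a (.C x) (.C y) (.C z) .X
  obtain ⟨P₁, h₁⟩ := exists_divided_difference A B u
  obtain ⟨P₂, h₂⟩ := exists_divided_difference P₁ B v
  simp only [hA, hB] at h₁ h₂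
  exact ⟨P₂.eval w, P₁.eval v, P₁.eval w, h₁ v, h₁ w, h₂ w⟩

theorem dlFour_eq_div {K : Type*} [Field K] (a : ℕ) (x y z : K) {t : K} (ht : t ≠ 0)
    (h : dlDen a x y z t ≠ 0) : dlFour a x y z t = dlNum a x y z t / dlDen a x y z t := by
  rw [dlFour, dlNum, ← mul_dlDen, add_div, div_self h, ← mul_div_mul_left _ (dlDen a x y z t) ht]
  congr 2
  ring

theorem dlFive_eq_div {K : Type*} [Field K] (a : ℕ) (x y z : K) {u v P : K} (hu : u ≠ 0)
    (hv : v ≠ 0) (huv : u ≠ v) (hdu : dlDen a x y z u ≠ 0) (hdv : dlDen a x y z v ≠ 0)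
    (hP : (u - v) * P =
      u * dlNum a x y z u * dlDen a x y z v - v * dlNum a x y z v * dlDen a x y z u) :
    dlFive a x y z u v = P / (dlDen a x y z u * dlDen a x y z v) := by
  have huv' := sub_ne_zero.2 huv
  rw [dlFive, dlFour_eq_div a x y z hu hdu, dlFour_eq_div a x y z hv hdv]
  rw [div_eq_div_iff huv' (mul_ne_zero hdu hdv)]
  field_simp
  linear_combination -hP

theorem dlSix_eq_div {K : Type*} [Field K] (a : ℕ) (x y z : K) {u v w P Pv Pw : K} (hu : u ≠ 0)
    (hv : v ≠ 0) (hw : w ≠ 0) (huv : u ≠ v) (huw : u ≠ w) (hvw : v ≠ w)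
    (hdu : dlDen a x y z u ≠ 0) (hdv : dlDen a x y z v ≠ 0) (hdw : dlDen a x y z w ≠ 0)
    (hPv : (u - v) * Pv =
      u * dlNum a x y z u * dlDen a x y z v - v * dlNum a x y z v * dlDen a x y z u)
    (hPw : (u - w) * Pw =
      u * dlNum a x y z u * dlDen a x y z w - w * dlNum a x y z w * dlDen a x y z u)
    (hP : (v - w) * P = v * Pv * dlDen a x y z w - w * Pw * dlDen a x y z v) :
    dlSix a x y z u v w = P / (dlDen a x y z u * dlDen a x y z v * dlDen a x y z w) := by
  have hvw' := sub_ne_zero.2 hvw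
  rw [dlSix, dlFive_eq_div a x y z hu hv huv hdu hdv hPv,
    dlFive_eq_div a x y z hu hw huw hdu hdw hPw]
  rw [div_eq_div_iff hvw' (mul_ne_zero (mul_ne_zero hdu hdv) hdw)]
  field_simp
  linear_combination -hP

end Fractions

/-! ### The Taylor expansion of the iterated divided difference -/

section SixVariables

open MvPowerSeries

/-- The Taylor expansion of `r(x,y,z,u)`, as a power series in the six variables
`x, y, z, u, v, w`. -/
def dlSeries (a : ℕ) : MvPowerSeries (Fin 6) ℚ :=
  dlNum a (X 0) (X 1) (X 2) (X 3) * (dlDen a (X 0) (X 1) (X 2) (X 3))⁻¹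

theorem constantCoeff_dlDen (a : ℕ) (i : Fin 6) :
    constantCoeff (dlDen a (X 0) (X 1) (X 2) (X i) : MvPowerSeries (Fin 6) ℚ) = -3 := by
  simp [dlDen, map_ofNat constantCoeff]

theorem dlDen_mul_dlSeries (a : ℕ) :
    dlDen a (X 0) (X 1) (X 2) (X 3) * dlSeries a = dlNum a (X 0) (X 1) (X 2) (X 3) := by
  rw [dlSeries, mul_left_comm, MvPowerSeries.mul_inv_cancel _ (by simp [constantCoeff_dlDen]),
    mul_one]

theorem WeightLE.dlDen {σ K : Type*} [Field K] {w : σ → ℤ} {x y z t : MvPowerSeries σ K}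
    (hx : WeightLE w 0 x) (hy : WeightLE w 0 y) (hz : WeightLE w 0 z) (ht : WeightLE w 0 t)
    (a : ℕ) : WeightLE w 0 (dlDen a x y z t) := by
  have h1 := weightLE_one (R := K) w
  have h3 := weightLE_ofNat (R := K) w 3
  have hs := (hx.add hy).add hz
  have hst := hs.mul_of_zero ht
  have hκ := (h1.sub hs).sub hst
  exact (((hs.add hst).sub h1).mul_of_zero
    ((h3.add ((h3.mul_of_zero ht).mul_of_zero hκ)).add ((ht.pow 2).mul_of_zero (hκ.pow 2)))).sub
    ((hx.add hy).mul_of_zero (WeightLE.sum fun i _ =>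
      ((h1.sub (hx.mul_of_zero ht)).sub (hy.mul_of_zero ht)).pow i))

theorem WeightLE.dlNum {σ K : Type*} [Field K] {w : σ → ℤ} {x y z t : MvPowerSeries σ K}
    (hx : WeightLE w 0 x) (hy : WeightLE w 0 y) (hz : WeightLE w 0 z) (ht : WeightLE w 0 t)
    (a : ℕ) : WeightLE w 0 (dlNum a x y z t) := by
  have h1 := weightLE_one (R := K) w
  have h3 := weightLE_ofNat (R := K) w 3
  have hs := ((hx.mul_of_zero ht).add (hy.mul_of_zero ht)).add (hz.mul_of_zero ht)
  exact (((h3.mul_of_zero ht).mul_of_zero ((ht.add h1).pow 2)).mul_of_zero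
    ((hs.sub h1).pow 3)).add (WeightLE.dlDen hx hy hz ht a)

theorem WeightLE.dlSeries {w : Fin 6 → ℤ} (hw : ∀ i ≤ 3, w i ≤ 0) (a : ℕ) :
    WeightLE w 0 (dlSeries a) := by
  have hX : ∀ i ≤ 3, WeightLE w 0 (X i : MvPowerSeries (Fin 6) ℚ) := fun i hi =>
    weightLE_X i (hw i hi)
  have h0 := hX 0 (by decide)
  have h1 := hX 1 (by decide)
  have h2 := hX 2 (by decide)
  have h3 := hX 3 (by decide)
  exact (WeightLE.dlNum h0 h1 h2 h3 a).mul_of_zero (WeightLE.dlDen h0 h1 h2 h3 a).inv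

/-- The Taylor expansion of `r₂` is obtained from that of `r` by splitting `u` into `u, v` and then
`v` into `v, w`. -/
theorem taylor_dlSix {a : ℕ} {P Pv Pw : MvPowerSeries (Fin 6) ℚ}
    (hPv : (X 3 - X 4) * Pv =
      X 3 * dlNum a (X 0) (X 1) (X 2) (X 3) * dlDen a (X 0) (X 1) (X 2) (X 4) -
      X 4 * dlNum a (X 0) (X 1) (X 2) (X 4) * dlDen a (X 0) (X 1) (X 2) (X 3))
    (hPw : (X 3 - X 5) * Pw =
      X 3 * dlNum a (X 0) (X 1) (X 2) (X 3) * dlDen a (X 0) (X 1) (X 2) (X 5) -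
      X 5 * dlNum a (X 0) (X 1) (X 2) (X 5) * dlDen a (X 0) (X 1) (X 2) (X 3))
    (hP : (X 4 - X 5) * P = X 4 * Pv * dlDen a (X 0) (X 1) (X 2) (X 5) -
      X 5 * Pw * dlDen a (X 0) (X 1) (X 2) (X 4)) :
    splitVar 4 5 (splitVar 3 4 (dlSeries a)) * (dlDen a (X 0) (X 1) (X 2) (X 3) *
      dlDen a (X 0) (X 1) (X 2) (X 4) * dlDen a (X 0) (X 1) (X 2) (X 5)) = P := by
  have hX : ∀ i j : Fin 6, i ≠ j → (X i - X j : MvPowerSeries (Fin 6) ℚ) ≠ 0 := fun i j hij h =>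
    hij (X_inj.1 (sub_eq_zero.1 h))
  -- the three specializations `u`, `v`, `w` of the last variable of `r`
  have hu := dlDen_mul_dlSeries a
  have hv := congrArg (rename (Equiv.swap (3 : Fin 6) 4)) hu
  have hw := congrArg (rename (Equiv.swap (4 : Fin 6) 5)) hv
  have hfix : rename (Equiv.swap (4 : Fin 6) 5) (dlSeries a) = dlSeries a := by
    have h := congrArg (rename (Equiv.swap (4 : Fin 6) 5)) hu
    simp only [map_mul, map_dlDen, map_dlNum, rename_X,
      show Equiv.swap (4 : Fin 6) 5 0 = 0 by decide, show Equiv.swap (4 : Fin 6) 5 1 = 1 by decide,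
      show Equiv.swap (4 : Fin 6) 5 2 = 2 by decide,
      show Equiv.swap (4 : Fin 6) 5 3 = 3 by decide] at h
    refine mul_left_cancel₀ (fun h0 => ?_) (h.trans hu.symm)
    simpa [h0] using constantCoeff_dlDen a 3
  simp only [map_mul, map_dlDen, map_dlNum, rename_X,
    show Equiv.swap (3 : Fin 6) 4 0 = 0 by decide, show Equiv.swap (3 : Fin 6) 4 1 = 1 by decide,
    show Equiv.swap (3 : Fin 6) 4 2 = 2 by decide, show Equiv.swap (3 : Fin 6) 4 3 = 4 by decide,
    show Equiv.swap (4 : Fin 6) 5 0 = 0 by decide, show Equiv.swap (4 : Fin 6) 5 1 = 1 by decide,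
    show Equiv.swap (4 : Fin 6) 5 2 = 2 by decide,
    show Equiv.swap (4 : Fin 6) 5 4 = 5 by decide] at hv hw
  have h4 : WeightLE (Pi.single 4 1) 0 (dlSeries a) := WeightLE.dlSeries (by decide) a
  have h5 : WeightLE (Pi.single 5 1) 0 (dlSeries a) := WeightLE.dlSeries (by decide) a
  have e1 := sub_mul_splitVar (by decide : (3 : Fin 6) ≠ 4) h4
  have e2 := congrArg (rename (Equiv.swap (4 : Fin 6) 5)) e1
  have e3 := sub_mul_splitVar (by decide : (4 : Fin 6) ≠ 5)
    (h5.splitVar (i := 3) (j := 4) (by decide) (by decide))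
  simp only [map_mul, map_sub, rename_X, hfix, show Equiv.swap (4 : Fin 6) 5 3 = 3 by decide,
    show Equiv.swap (4 : Fin 6) 5 4 = 5 by decide] at e2
  generalize dlDen a (X 0) (X 1) (X 2) (X 3 : MvPowerSeries (Fin 6) ℚ) = du at *
  generalize dlDen a (X 0) (X 1) (X 2) (X 4 : MvPowerSeries (Fin 6) ℚ) = dv at *
  generalize dlDen a (X 0) (X 1) (X 2) (X 5 : MvPowerSeries (Fin 6) ℚ) = dw at *
  have k1 : splitVar 3 4 (dlSeries a) * (du * dv) = Pv := by
    refine mul_left_cancel₀ (hX 3 4 (by decide)) ?_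
    linear_combination du * dv * e1 + X 3 * dv * hu - X 4 * du * hv - hPv
  have k2 : rename (Equiv.swap (4 : Fin 6) 5) (splitVar 3 4 (dlSeries a)) * (du * dw) = Pw := by
    refine mul_left_cancel₀ (hX 3 5 (by decide)) ?_
    linear_combination du * dw * e2 + X 3 * dw * hu - X 5 * du * hw - hPw
  refine mul_left_cancel₀ (hX 4 5 (by decide)) ?_
  linear_combination du * dv * dw * e3 + X 4 * dw * k1 - X 5 * dv * k2 - hP

/-- The diagonal exponent of the six variables comes from the exponent `(m,m,m,3m,0,0)` before the
two splittings. -/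
theorem coeff_diag_splitVar_splitVar (G : MvPowerSeries (Fin 6) ℚ) (m : ℕ) :
    PowerSeries.coeff m (diag (splitVar 4 5 (splitVar 3 4 G))) =
      coeff (Finsupp.equivFunOnFinite.symm ![m, m, m, 3 * m, 0, 0]) G := by
  rw [diag, PowerSeries.coeff_mk, coeff_splitVar, coeff_splitVar]
  refine congrArg (fun t => coeff t G) (Finsupp.ext fun i => ?_)
  fin_cases i <;> simp [mergeExp, Function.update]
  ring

end SixVariables

/-! ### Substitution of monomials -/

open MvPowerSeries

section MonomialSubst

variable {σ τ R : Type*} [Finite σ] [CommRing R] {m : σ → τ →₀ ℕ}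

theorem hasSubst_monomial (hm : ∀ i, m i ≠ 0) :
    HasSubst fun i => (monomial (m i) 1 : MvPowerSeries τ R) := by
  classical
  refine hasSubst_of_constantCoeff_zero fun i => ?_
  rw [← coeff_zero_eq_constantCoeff_apply, coeff_monomial, if_neg (hm i).symm]

/-- The exponents of the series `F(monomial (m 0), monomial (m 1), …)` are the combinations of
the exponents `m i`. -/
theorem coeff_subst_monomial [DecidableEq τ] (hm : ∀ i, m i ≠ 0) (F : MvPowerSeries σ R)
    (s : τ →₀ ℕ) :
    coeff s (subst (fun i => (monomial (m i) 1 : MvPowerSeries τ R)) F) =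
      finsum fun d => if s = d.sum fun i n => n • m i then coeff d F else 0 := by
  rw [coeff_subst (hasSubst_monomial hm)]
  refine finsum_congr fun d => ?_
  have : (d.prod fun i n => (monomial (m i) 1 : MvPowerSeries τ R) ^ n) =
      monomial (d.sum fun i n => n • m i) 1 := by
    simp only [monomial_pow, Finsupp.prod, prod_monomial, Finsupp.sum, one_pow,
      Finset.prod_const_one]
  rw [this, coeff_monomial]
  split_ifs <;> simp

theorem weightLE_subst_monomial {w : τ → ℤ} (hm : ∀ i, m i ≠ 0)
    (hw : ∀ i, Finsupp.weight w (m i) = 0) (F : MvPowerSeries σ R) :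
    WeightLE w 0 (subst (fun i => (monomial (m i) 1 : MvPowerSeries τ R)) F) := by
  classical
  intro s hs
  rw [coeff_subst_monomial hm]
  refine finsum_eq_zero_of_forall_eq_zero fun d => if_neg ?_
  rintro rfl
  rw [map_finsuppSum, Finsupp.sum_congr (g2 := fun _ _ => 0) (by simp [hw])] at hs
  simp at hs

end MonomialSubst

/-! ### The residue argument -/

/-- The exponents of `x u`, `y u`, `z u`. -/
def homogExp (i : Fin 3) : Fin 6 →₀ ℕ :=
  Finsupp.single (i.castLE (by decide)) 1 + Finsupp.single 3 1

theorem homogExp_ne_zero (i : Fin 3) : homogExp i ≠ 0 := by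
  intro h
  have := DFunLike.congr_fun h 3
  simp [homogExp] at this

/-- The substitution `F(x,y,z) ↦ F(xu,yu,zu)`, with `u = X 3`. -/
def homog : MvPowerSeries (Fin 3) ℚ →ₐ[ℚ] MvPowerSeries (Fin 6) ℚ :=
  substAlgHom (hasSubst_monomial homogExp_ne_zero)

theorem homog_X (i : Fin 3) : homog (X i) = X (i.castLE (by decide)) * X 3 := by
  rw [homog, substAlgHom_X, X, X, monomial_mul_monomial, one_mul]
  rfl

/-- The weight in which `u` counts `1` and every other variable counts `-1`. -/
def excess : Fin 6 → ℤ := ![-1, -1, -1, 1, -1, -1]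

theorem weight_excess (s : Fin 6 →₀ ℕ) : Finsupp.weight excess s =
    s 3 - s 0 - s 1 - s 2 - s 4 - s 5 := by
  rw [Finsupp.weight_eq_sum, Fin.sum_univ_six]
  simp [excess]
  ring

theorem weight_neg_excess (s : Fin 6 →₀ ℕ) :
    Finsupp.weight (-excess) s = -Finsupp.weight excess s := by
  simp [Finsupp.weight_eq_sum]

theorem weightLE_homog (F : MvPowerSeries (Fin 3) ℚ) : WeightLE excess 0 (homog F) := by
  rw [homog, substAlgHom_apply]
  refine weightLE_subst_monomial homogExp_ne_zero (fun i => ?_) F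
  rw [weight_excess]
  fin_cases i <;> simp [homogExp]

theorem weightLE_neg_homog (F : MvPowerSeries (Fin 3) ℚ) : WeightLE (-excess) 0 (homog F) := by
  rw [homog, substAlgHom_apply]
  refine weightLE_subst_monomial homogExp_ne_zero (fun i => ?_) F
  rw [weight_neg_excess, weight_excess]
  fin_cases i <;> simp [homogExp]

theorem coeff_homog (F : MvPowerSeries (Fin 3) ℚ) (m : ℕ) :
    coeff (Finsupp.equivFunOnFinite.symm ![m, m, m, 3 * m, 0, 0]) (homog F) =
      coeff (Finsupp.equivFunOnFinite.symm fun _ => m) F := by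
  have key : ∀ d : Fin 3 →₀ ℕ, (d.sum fun i n => n • homogExp i) =
      Finsupp.equivFunOnFinite.symm ![d 0, d 1, d 2, d 0 + d 1 + d 2, 0, 0] := by
    intro d
    rw [Finsupp.sum_fintype _ _ (by simp), Fin.sum_univ_three]
    ext i
    fin_cases i <;> simp [homogExp]
  rw [homog, substAlgHom_apply, coeff_subst_monomial homogExp_ne_zero,
    finsum_eq_single _ (Finsupp.equivFunOnFinite.symm fun _ => m)]
  · rw [key, if_pos]
    simp [show m + m + m = 3 * m by ring]
  · intro d hd
    rw [key, if_neg]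
    intro h
    apply hd
    ext i
    have h0 := DFunLike.congr_fun h 0
    have h1 := DFunLike.congr_fun h 1
    have h2 := DFunLike.congr_fun h 2
    fin_cases i <;> simp_all

theorem constantCoeff_homog (F : MvPowerSeries (Fin 3) ℚ) :
    constantCoeff (homog F) = constantCoeff F := by
  have h := coeff_homog F 0
  have e1 : (Finsupp.equivFunOnFinite.symm ![0, 0, 0, 3 * 0, 0, 0] : Fin 6 →₀ ℕ) = 0 := by
    ext i; fin_cases i <;> rfl
  have e2 : (Finsupp.equivFunOnFinite.symm fun _ => 0 : Fin 3 →₀ ℕ) = 0 := by ext i; rfl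
  rwa [e1, e2] at h

/-- The algebraic equation of `h = (1-x-y)^(a/3) / (1-x-y-z)`, which says that `h - 1` is a root of
`p(x,y,z,t) = ((x+y+z-1)(t+1))³ + (1-x-y)^a`. -/
theorem algebraicSeries_cube (a : ℕ) :
    algebraicSeries (a / 3) ^ 3 * (1 - X 0 - X 1 - X 2) ^ 3 = (1 - X 0 - X 1) ^ a := by
  rw [← mul_pow, algebraicSeries, mul_assoc, MvPowerSeries.inv_mul_cancel _ (by simp), mul_one,
    ratPow_pow (by simp), ← ratPow_natCast (by simp)]
  congr 1
  push_cast
  ring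

/-- With `H = 1 + t ψ` and `T = t + 1`, so that `T - H = t (1 - ψ)`, this is
`3 T² / (T³ - H³) = 1 / (T - H) + (2 T + H) / (T² + T H + H²)`, multiplied by `t²`, where
`t² / (T - H) = t / (1 - ψ)` is written as `t + t ψ + t ψ² / (1 - ψ)`. The factor `e` stands for
`(xt+yt+zt-1)³`, and `e (1 - ψ) Y` for `dlDen`. -/
theorem partial_fractions {R : Type*} [CommRing R] {t ψ H Y I J e : R} (hH : H = 1 + t * ψ)
    (hY : Y = (t + 1) ^ 2 + (t + 1) * H + H ^ 2) (hI : (1 - ψ) * I = 1) (hJ : Y * J = 1) :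
    3 * t * (t + 1) ^ 2 * e + e * (1 - ψ) * Y = e * (1 - ψ) * Y *
      (H + t + (H - 1) * (ψ * I) + t * (t * ((2 * (t + 1) + H) * J))) := by
  subst hH
  linear_combination -e * t * Y * ψ ^ 2 * hI -
    e * (1 - ψ) * t ^ 2 * (2 * (t + 1) + (1 + t * ψ)) * hJ - e * t * hY

/-- The coefficients of `r` at `(xyz)^m u^(3m)` are the diagonal coefficients of
`h = algebraicSeries (a / 3)`: in `r = H + u + (H - 1) ψ / (1 - ψ) + u² (2 (u + 1) + H) / Y`,
where `H = h(xu,yu,zu) = 1 + u ψ`, the monomials of the three terms after `H` have positive,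
negative and positive weight, respectively. -/
theorem coeff_dlSeries (a m : ℕ) :
    coeff (Finsupp.equivFunOnFinite.symm ![m, m, m, 3 * m, 0, 0]) (dlSeries a) =
      PowerSeries.coeff m (diag (algebraicSeries (a / 3))) := by
  set H := homog (algebraicSeries (a / 3)) with hH
  have hcc : constantCoeff (algebraicSeries (a / 3)) = 1 := by
    simp [algebraicSeries, constantCoeff_ratPow]
  have hcube : H ^ 3 * (1 - X 0 * X 3 - X 1 * X 3 - X 2 * X 3) ^ 3 =
      (1 - X 0 * X 3 - X 1 * X 3) ^ a := by
    have := congrArg homog (algebraicSeries_cube a)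
    simpa [homog_X] using this
  have hHc : constantCoeff H = 1 := by rw [hH, constantCoeff_homog, hcc]
  have hle : WeightLE excess 0 H := weightLE_homog _
  have hge : WeightLE (-excess) 0 H := weightLE_neg_homog _
  -- a monomial without `u` has weight `0` only if it is constant
  obtain ⟨ψ, hψ⟩ : X 3 ∣ H - 1 := by
    rw [X_dvd_iff]
    intro s hs
    by_cases h0 : s = 0
    · subst h0; simp [hHc]
    · refine ((hge.sub (weightLE_one _)) s ?_)
      rw [weight_neg_excess, weight_excess]
      by_contra hneg
      refine h0 (Finsupp.ext fun i => ?_)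
      fin_cases i <;> simp <;> omega
  have hψw : WeightLE excess (-1) ψ := by
    intro s hs
    have : coeff (Finsupp.single 3 1 + s) (H - 1) = coeff s ψ := by
      rw [hψ, X, coeff_add_monomial_mul, one_mul]
    rw [← this]
    refine (hle.sub (weightLE_one _)) _ ?_
    rw [map_add, Finsupp.weight_single]
    simp [excess] at hs ⊢
    linarith
  have hψc : constantCoeff ψ = 0 := hψw 0 (by simp)
  set Y : MvPowerSeries (Fin 6) ℚ := (X 3 + 1) ^ 2 + (X 3 + 1) * H + H ^ 2 with hY
  have hYc : constantCoeff Y ≠ 0 := by simp [hY, hHc]; norm_num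
  have hYinv := MvPowerSeries.mul_inv_cancel Y hYc
  have hψ1c : constantCoeff (1 - ψ) ≠ 0 := by simp [hψc]
  have hψinv := MvPowerSeries.mul_inv_cancel (1 - ψ) hψ1c
  have hX3 : (X 3 : MvPowerSeries (Fin 6) ℚ) ≠ 0 := by
    intro h
    simpa using congrArg (coeff (Finsupp.single 3 1)) h
  have hHψ : H = 1 + X 3 * ψ := by rw [← hψ]; ring
  have hden : dlDen a (X 0) (X 1) (X 2) (X 3) =
      (X 0 * X 3 + X 1 * X 3 + X 2 * X 3 - 1) ^ 3 * (1 - ψ) * Y := by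
    refine mul_left_cancel₀ hX3 ?_
    rw [mul_dlDen, ← hcube, hY, hHψ]
    ring
  have hG : dlSeries a = H + X 3 + (H - 1) * (ψ * (1 - ψ)⁻¹) +
      X 3 * (X 3 * ((2 * (X 3 + 1) + H) * Y⁻¹)) := by
    have hd0 : dlDen a (X 0) (X 1) (X 2) (X 3) ≠ (0 : MvPowerSeries (Fin 6) ℚ) := fun h => by
      simpa [h] using constantCoeff_dlDen a 3
    refine mul_left_cancel₀ hd0 ?_
    rw [dlDen_mul_dlSeries, dlNum, hden]
    exact partial_fractions hHψ hY hψinv hYinv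
  have hX : WeightLE (-excess) (-1) (X 3 : MvPowerSeries (Fin 6) ℚ) :=
    weightLE_X 3 (by simp [excess])
  have hw : Finsupp.weight excess (Finsupp.equivFunOnFinite.symm ![m, m, m, 3 * m, 0, 0]) = 0 := by
    rw [weight_excess]
    simp
    ring
  have hX0 := weightLE_X (R := ℚ) (w := -excess) (k := 0) 3 (by simp [excess])
  have hT := hX0.add (weightLE_one _)
  have hYw : WeightLE (-excess) 0 Y := ((hT.pow 2).add (hT.mul_of_zero hge)).add (hge.pow 2)
  have h3 := (hle.sub (weightLE_one _)).mul (hψw.mul ((weightLE_one _).sub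
    (hψw.mono (by norm_num))).inv)
  have h4 := hX.mul (hX.mul ((((weightLE_ofNat _ 2).mul_of_zero hT).add hge).mul_of_zero hYw.inv))
  -- the exponent `(m,m,m,3m,0,0)` has weight `0`, so only `H` contributes
  rw [hG, map_add, map_add, map_add, hX _ (by rw [weight_neg_excess, hw]; norm_num),
    h3 _ (by rw [hw]; norm_num), h4 _ (by rw [weight_neg_excess, hw]; norm_num), hH, coeff_homog,
    diag, PowerSeries.coeff_mk]
  ring

/-! ### The six-variable rational function -/

/-- The denominator is `dlDen(u) dlDen(v) dlDen(w)`; the same three identities for the numerators,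
mapped into the field of rational functions and into the power series, give the fraction and its
Taylor expansion. -/
theorem IsDiagonalOfRational.denefLipshitz (a : ℕ) :
    IsDiagonalOfRational (denefLipshitz a) (diag (algebraicSeries (a / 3))) := by
  obtain ⟨P, Pv, Pw, hPv, hPw, hP⟩ := exists_numerators a
    (MvPolynomial.X 0 : MvPolynomial (Fin 6) ℚ) (MvPolynomial.X 1) (MvPolynomial.X 2)
    (MvPolynomial.X 3) (MvPolynomial.X 4) (MvPolynomial.X 5)
  let ι := algebraMap (MvPolynomial (Fin 6) ℚ) (RationalFunction (Fin 6))
  let κ := MvPolynomial.coeToMvPowerSeries.ringHom (R := ℚ) (σ := Fin 6)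
  let D : Fin 6 → MvPolynomial (Fin 6) ℚ := fun i =>
    dlDen a (MvPolynomial.X 0) (MvPolynomial.X 1) (MvPolynomial.X 2) (MvPolynomial.X i)
  have hκX : ∀ i, κ (MvPolynomial.X i) = X i := fun i => by simp [κ]
  have hκD : ∀ i, κ (D i) = dlDen a (X 0) (X 1) (X 2) (X i) := fun i => by
    simp only [D, map_dlDen, hκX]
  have hDc : ∀ i, MvPolynomial.constantCoeff (D i) = -3 := fun i => by
    have h : constantCoeff (κ (D i)) = MvPolynomial.constantCoeff (D i) :=
      MvPolynomial.coeff_coe (D i) 0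
    rw [← h, hκD, constantCoeff_dlDen]
  have hι : Function.Injective ι := IsFractionRing.injective _ _
  have hD0 : ∀ i, dlDen a (var 0) (var 1) (var 2) (var i) ≠ 0 := fun i => by
    have h : ι (D i) = dlDen a (var 0) (var 1) (var 2) (var i) := map_dlDen ι ..
    rw [← h, map_ne_zero_iff ι hι]
    intro h0
    simpa [h0] using hDc i
  have hv0 : ∀ i, var i ≠ 0 := fun i => by
    rw [var, map_ne_zero_iff ι hι]
    exact MvPolynomial.X_ne_zero i
  have hvne : ∀ i j, i ≠ j → var i ≠ var j := fun i j hij h =>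
    hij (MvPolynomial.X_injective (hι h))
  have hQ : MvPolynomial.constantCoeff (D 3 * D 4 * D 5) ≠ 0 := by
    simp [hDc]
  refine ⟨P, D 3 * D 4 * D 5, hQ, ?_, ?_⟩
  · have eV := congrArg ι hPv
    have eW := congrArg ι hPw
    have eP := congrArg ι hP
    simp only [map_mul, map_sub, map_dlDen, map_dlNum] at eV eW eP
    simp only [map_mul, D, map_dlDen]
    exact dlSix_eq_div a _ _ _ (hv0 3) (hv0 4) (hv0 5) (hvne 3 4 (by decide))
      (hvne 3 5 (by decide)) (hvne 4 5 (by decide)) (hD0 3) (hD0 4) (hD0 5) eV eW eP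
  · have eV := congrArg κ hPv
    have eW := congrArg κ hPw
    have eP := congrArg κ hP
    simp only [map_mul, map_sub, map_dlDen, map_dlNum, hκX] at eV eW eP
    have h := taylor_dlSix eV eW eP
    rw [← hκD, ← hκD, ← hκD, ← map_mul, ← map_mul] at h
    have hQ' : constantCoeff (κ (D 3 * D 4 * D 5)) ≠ 0 := by
      have h : constantCoeff (κ (D 3 * D 4 * D 5)) = MvPolynomial.constantCoeff (D 3 * D 4 * D 5) :=
        MvPolynomial.coeff_coe _ 0
      rwa [h]
    have h' : (P : MvPowerSeries (Fin 6) ℚ) *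
        ((D 3 * D 4 * D 5 : MvPolynomial (Fin 6) ℚ) : MvPowerSeries (Fin 6) ℚ)⁻¹ =
          splitVar 4 5 (splitVar 3 4 (dlSeries a)) :=
      ((MvPowerSeries.eq_mul_inv_iff_mul_eq hQ').2 h).symm
    rw [h']
    ext m
    rw [coeff_diag_splitVar_splitVar, coeff_dlSeries]

end ChristolDiag

end

theorem mainTheorem1 :
    -- the two hypergeometric series are diagonals of algebraic functions
    PowerSeries.rescale (27 : ℚ)
        (ChristolDiag.hypergeometric [2 / 9, 5 / 9, 8 / 9] [2 / 3, 1]) =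
      ChristolDiag.diag (ChristolDiag.algebraicSeries (1 / 3)) ∧
    PowerSeries.rescale (27 : ℚ)
        (ChristolDiag.hypergeometric [1 / 9, 4 / 9, 7 / 9] [1 / 3, 1]) =
      ChristolDiag.diag (ChristolDiag.algebraicSeries (2 / 3)) ∧
    -- they are the diagonals of explicit rational functions in six variables
    ChristolDiag.IsDiagonalOfRational (ChristolDiag.denefLipshitz 1)
      (PowerSeries.rescale (27 : ℚ)
        (ChristolDiag.hypergeometric [2 / 9, 5 / 9, 8 / 9] [2 / 3, 1])) ∧
    ChristolDiag.IsDiagonalOfRational (ChristolDiag.denefLipshitz 2)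
      (PowerSeries.rescale (27 : ℚ)
        (ChristolDiag.hypergeometric [1 / 9, 4 / 9, 7 / 9] [1 / 3, 1])) ∧
    -- in particular the candidates, with argument `x` or `3 ^ 6 x`, are diagonals
    (∀ c : ℚ, c = 1 ∨ c = 3 ^ 6 →
      (∃ R : ChristolDiag.RationalFunction (Fin 6), ChristolDiag.IsDiagonalOfRational R
        (PowerSeries.rescale c
          (ChristolDiag.hypergeometric [2 / 9, 5 / 9, 8 / 9] [2 / 3, 1]))) ∧
      (∃ R : ChristolDiag.RationalFunction (Fin 6), ChristolDiag.IsDiagonalOfRational R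
        (PowerSeries.rescale c
          (ChristolDiag.hypergeometric [1 / 9, 4 / 9, 7 / 9] [1 / 3, 1])))) := by
  have h1 := ChristolDiag.rescale_hypergeometric_eq_diag (b := 2 / 3) (by norm_num)
  have h2 := ChristolDiag.rescale_hypergeometric_eq_diag (b := 1 / 3) (by norm_num)
  norm_num1 at h1 h2
  have d1 := ChristolDiag.IsDiagonalOfRational.denefLipshitz 1
  have d2 := ChristolDiag.IsDiagonalOfRational.denefLipshitz 2
  norm_num1 at d1 d2
  rw [← h1] at d1
  rw [← h2] at d2
  refine ⟨h1, h2, d1, d2, fun c _ => ?_⟩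
  -- every argument `c x` is `27 x` rescaled by `c / 27`
  have hc : c = 27 * (c / 27) := by ring
  constructor
  · rw [hc, PowerSeries.rescale_mul]
    exact d1.rescale _
  · rw [hc, PowerSeries.rescale_mul]
    exact d2.rescale _
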